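/- Let $n \ge 2$ and let $\lambda$ be a partition of $n$, identified with its Young diagram. For a box $x$ of $\lambda$, let its content $c(x)$ be the column number of $x$ minus the row number of $x$. A standard Young tableau of shape $\lambda$ is a filling of the boxes of $\lambda$ with the numbers $1,\dots,n$, each occurring exactly once, such that the numbers increase along rows (from left to right) and down columns. Let $T$ be a standard Young tableau of shape $\lambda$ chosen uniformly at random. Then, for every $1 \le j \le n$, the expected value of the content of the box of $T$ containing $j$ is $$\frac{j-1}{\binom{n}{2}} \sum_{x \in \lambda} c(x).$$ -/

import Mathlib

open scoped MeasureTheory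

namespace YoungDiagram

/-- The content of the box in row `x.1` and column `x.2`: column number minus row number. -/
def content (x : ℕ × ℕ) : ℤ := (x.2 : ℤ) - (x.1 : ℤ)

/-- A standard Young tableau of shape `μ`: the boxes of `μ` are filled with the numbers
`1, …, |μ|`, each occurring exactly once, increasing along rows and down columns. -/
@[ext]
structure StandardTableau (μ : YoungDiagram) where
  /-- The number written in a box. -/
  entry : {x // x ∈ μ.cells} ≃ {k // k ∈ Finset.Icc 1 μ.card}
  /-- Entries increase from left to right in every row. -/
  row_strict : ∀ x y : {x // x ∈ μ.cells},
    x.1.1 = y.1.1 → x.1.2 < y.1.2 → (entry x : ℕ) < (entry y : ℕ)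
  /-- Entries increase downwards in every column. -/
  col_strict : ∀ x y : {x // x ∈ μ.cells},
    x.1.2 = y.1.2 → x.1.1 < y.1.1 → (entry x : ℕ) < (entry y : ℕ)

namespace StandardTableau

variable {μ : YoungDiagram}

/-- The box of `T` that contains the number `j`. -/
def box (T : StandardTableau μ) (j : {k // k ∈ Finset.Icc 1 μ.card}) : ℕ × ℕ :=
  (T.entry.symm j).1

theorem entry_injective :
    Function.Injective (StandardTableau.entry : StandardTableau μ → _) := by
  intro S T h
  ext1
  exact h

instance instFinite : Finite (StandardTableau μ) :=
  Finite.of_injective _ entry_injective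

noncomputable instance instFintype : Fintype (StandardTableau μ) := Fintype.ofFinite _

/-- Numbering the boxes row by row gives a standard tableau. -/
instance instNonempty : Nonempty (StandardTableau μ) := by
  classical
  let s : Finset (ℕ ×ₗ ℕ) := μ.cells.map (toLex : ℕ × ℕ ≃ ℕ ×ₗ ℕ).toEmbedding
  have hs : s.card = μ.card := Finset.card_map _
  have ht : (Finset.Icc 1 μ.card).card = μ.card := by simp
  let e : s ≃o Finset.Icc 1 μ.card :=
    (s.orderIsoOfFin hs).symm.trans ((Finset.Icc 1 μ.card).orderIsoOfFin ht)
  let f : {x // x ∈ μ.cells} ≃ s :=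
    (toLex : ℕ × ℕ ≃ ℕ ×ₗ ℕ).subtypeEquiv (fun a => by simp [s])
  refine ⟨⟨f.trans e.toEquiv, ?_, ?_⟩⟩
  · intro x y h1 h2
    have : f x < f y := by
      change toLex x.1 < toLex y.1
      rw [Prod.Lex.toLex_lt_toLex]
      exact Or.inr ⟨h1, h2⟩
    exact e.strictMono this
  · intro x y h1 h2
    have : f x < f y := by
      change toLex x.1 < toLex y.1
      rw [Prod.Lex.toLex_lt_toLex]
      exact Or.inl h2
    exact e.strictMono this

/-- Every set of tableaux is an event. -/
instance instMeasurableSpace : MeasurableSpace (StandardTableau μ) := ⊤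

/-- The uniform probability measure on the standard Young tableaux of shape `μ`. -/
noncomputable def uniform (μ : YoungDiagram) : MeasureTheory.Measure (StandardTableau μ) :=
  (PMF.uniformOfFintype (StandardTableau μ)).toMeasure

end StandardTableau

end YoungDiagram

/-! Let c_j be the content of the box of j. It suffices that D, the sum over all tableaux of c_{j+1}
- c_j, does not depend on j: since c_1 = 0, the sum of c_j is then (j-1)D, and summing over j
determines D from the total content. Exchanging j and j+1 whenever |c_{j+1} - c_j| ≠ 1 is an
involution that reverses the difference, so only differences ±1 contribute to D
(`sum_sub_eq_sum_unitDiff`). Composing the exchanges at j and j+1 matches these contributions at j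
with those at j+1, up to error terms that cancel under one exchange
(`sum_unitDiff_eq_sum_unitDiff`). -/

/-! ### Sign-reversing involutions on integer-valued functions -/

/-- The difference `v - u` if it is `1` or `-1`, and zero otherwise. -/
def unitDiff (u v : ℤ) : ℤ := if v - u = 1 ∨ v - u = -1 then v - u else 0

theorem Fintype.sum_eq_zero_of_involutive_neg {X : Type*} [Fintype X] {s : X → X}
    (hs : Function.Involutive s) {f : X → ℤ} (hf : ∀ x, f (s x) = -f x) : ∑ x, f x = 0 := by
  have h : ∑ x, f (s x) = ∑ x, f x := Equiv.sum_comp hs.toPerm f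
  simp only [hf, Finset.sum_neg_distrib] at h
  omega

/-- If an involution exchanges the values `a` and `b` wherever they do not differ by `1`, then only
the places where they do differ by `1` contribute to the sum of `b - a`. -/
theorem sum_sub_eq_sum_unitDiff {X : Type*} [Fintype X] {a b : X → ℤ} {s : X → X}
    (hs : Function.Involutive s)
    (hfix : ∀ x, b x - a x = 1 ∨ b x - a x = -1 → s x = x)
    (hswap : ∀ x, ¬(b x - a x = 1 ∨ b x - a x = -1) → a (s x) = b x ∧ b (s x) = a x) :
    ∑ x, (b x - a x) = ∑ x, unitDiff (a x) (b x) := by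
  rw [← sub_eq_zero, ← Finset.sum_sub_distrib]
  refine Fintype.sum_eq_zero_of_involutive_neg hs fun x => ?_
  unfold unitDiff
  by_cases h : b x - a x = 1 ∨ b x - a x = -1
  · simp [hfix x h, h]
  · obtain ⟨h1, h2⟩ := hswap x h
    rw [h1, h2]
    split_ifs <;> omega

/-- The braid argument: three values `a`, `b`, `c` with partial exchanges `s` of `a, b` and `t` of
`b, c`. The signed number of adjacencies between `a` and `b` equals that between `b` and `c`. -/
theorem sum_unitDiff_eq_sum_unitDiff {X : Type*} [Fintype X] {a b c : X → ℤ} {s t : X → X}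
    (hs : Function.Involutive s) (ht : Function.Involutive t)
    (hab : ∀ x, a x ≠ b x) (hbc : ∀ x, b x ≠ c x) (hac : ∀ x, a x ≠ c x)
    (hsfix : ∀ x, b x - a x = 1 ∨ b x - a x = -1 → s x = x)
    (hsswap : ∀ x, ¬(b x - a x = 1 ∨ b x - a x = -1) →
      a (s x) = b x ∧ b (s x) = a x ∧ c (s x) = c x)
    (htfix : ∀ x, c x - b x = 1 ∨ c x - b x = -1 → t x = x)
    (htswap : ∀ x, ¬(c x - b x = 1 ∨ c x - b x = -1) →
      a (t x) = a x ∧ b (t x) = c x ∧ c (t x) = b x) :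
    ∑ x, unitDiff (a x) (b x) = ∑ x, unitDiff (b x) (c x) := by
  -- `L` and `R` are the errors of the matching by `s ∘ t`; they occur where exactly one of the
  -- pairs `a, b` and `b, c` is adjacent and `a, c` is adjacent too.
  let L : X → ℤ := fun x =>
    if (b x - a x = 1 ∨ b x - a x = -1) ∧ ¬(c x - b x = 1 ∨ c x - b x = -1) ∧
      (c x - a x = 1 ∨ c x - a x = -1) then b x - a x else 0
  let R : X → ℤ := fun x =>
    if (c x - b x = 1 ∨ c x - b x = -1) ∧ ¬(b x - a x = 1 ∨ b x - a x = -1) ∧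
      (c x - a x = 1 ∨ c x - a x = -1) then c x - a x else 0
  have hL : ∑ x, L x = 0 := by
    refine Fintype.sum_eq_zero_of_involutive_neg ht fun x => ?_
    -- Where `L` is nonzero, `b` and `c` are distinct neighbours of `a`, hence on opposite sides of
    -- it: exchanging them flips the sign.
    have := hbc x
    by_cases h : c x - b x = 1 ∨ c x - b x = -1
    · simp only [L, htfix x h, not_true_eq_false, h, false_and, and_false, if_false, neg_zero]
    · obtain ⟨h1, h2, h3⟩ := htswap x h
      simp only [L, h1, h2, h3]
      split_ifs <;> omega
  have hR : ∑ x, R x = 0 := by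
    refine Fintype.sum_eq_zero_of_involutive_neg hs fun x => ?_
    have := hab x
    by_cases h : b x - a x = 1 ∨ b x - a x = -1
    · simp only [R, hsfix x h, not_true_eq_false, h, false_and, and_false, if_false, neg_zero]
    · obtain ⟨h1, h2, h3⟩ := hsswap x h
      simp only [R, h1, h2, h3]
      split_ifs <;> omega
  -- When both exchanges act, `s ∘ t` turns `(a, b, c)` into `(c, a, b)`. When neither acts, `a ≠ c`
  -- forces `b - a = c - b`. The mixed cases produce `L` and `R`.
  have key : ∀ x, unitDiff (a x) (b x) =
      unitDiff (b (s (t x))) (c (s (t x))) + L x - R x := by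
    intro x
    have h1 := hab x
    have h2 := hbc x
    have h3 := hac x
    simp only [L, R, unitDiff]
    by_cases h : c x - b x = 1 ∨ c x - b x = -1
    · rw [htfix x h]
      by_cases h' : b x - a x = 1 ∨ b x - a x = -1
      · rw [hsfix x h']
        split_ifs <;> omega
      · obtain ⟨e1, e2, e3⟩ := hsswap x h'
        rw [e2, e3]
        split_ifs <;> omega
    · obtain ⟨d1, d2, d3⟩ := htswap x h
      by_cases h' : b (t x) - a (t x) = 1 ∨ b (t x) - a (t x) = -1
      · rw [hsfix _ h', d2, d3]
        rw [d1, d2] at h'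
        split_ifs <;> omega
      · obtain ⟨e1, e2, e3⟩ := hsswap _ h'
        rw [e2, e3, d1, d3]
        rw [d1, d2] at h'
        split_ifs <;> omega
  have hst : ∑ x, unitDiff (b (s (t x))) (c (s (t x))) = ∑ x, unitDiff (b x) (c x) :=
    Equiv.sum_comp (ht.toPerm.trans hs.toPerm) fun x => unitDiff (b x) (c x)
  rw [Finset.sum_congr rfl fun x _ => key x, Finset.sum_sub_distrib, Finset.sum_add_distrib,
    hL, hR, hst]
  omega

/-! ### Contents of entries in a standard tableau -/

namespace YoungDiagram

namespace StandardTableau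

variable {μ : YoungDiagram}

theorem entry_lt_of_le_of_ne (T : StandardTableau μ) {x y : {x // x ∈ μ.cells}}
    (h1 : x.1.1 ≤ y.1.1) (h2 : x.1.2 ≤ y.1.2) (hne : x ≠ y) :
    (T.entry x : ℕ) < T.entry y := by
  obtain ⟨⟨r, k⟩, hx⟩ := x
  obtain ⟨⟨r', k'⟩, hy⟩ := y
  simp only at h1 h2
  have hz : (r, k') ∈ μ.cells :=
    (YoungDiagram.mem_cells _).2 (μ.up_left_mem h1 le_rfl ((YoungDiagram.mem_cells _).1 hy))
  have hrow : k < k' → (T.entry ⟨(r, k), hx⟩ : ℕ) < T.entry ⟨(r, k'), hz⟩ :=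
    fun h => T.row_strict _ _ rfl h
  have hcol : r < r' → (T.entry ⟨(r, k'), hz⟩ : ℕ) < T.entry ⟨(r', k'), hy⟩ :=
    fun h => T.col_strict _ _ rfl h
  rcases h1.eq_or_lt with rfl | h1
  · rcases h2.eq_or_lt with rfl | h2
    · exact absurd rfl hne
    · exact hrow h2
  · rcases h2.eq_or_lt with rfl | h2
    · exact hcol h1
    · exact (hrow h2).trans (hcol h1)

/-- The content of the box that contains `j`, or zero if there is none. -/
def contentAt (T : StandardTableau μ) (j : ℕ) : ℤ :=
  if h : j ∈ Finset.Icc 1 μ.card then content (T.box ⟨j, h⟩) else 0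

theorem contentAt_of_mem (T : StandardTableau μ) {j : ℕ} (h : j ∈ Finset.Icc 1 μ.card) :
    T.contentAt j = content (T.box ⟨j, h⟩) := dif_pos h

theorem contentAt_entry (T : StandardTableau μ) (x : {x // x ∈ μ.cells}) :
    T.contentAt (T.entry x) = content x.1 := by
  rw [T.contentAt_of_mem (T.entry x).2]
  simp [box]

theorem exists_entry_eq (T : StandardTableau μ) {j : ℕ} (h : j ∈ Finset.Icc 1 μ.card) :
    ∃ x, (T.entry x : ℕ) = j :=
  ⟨T.entry.symm ⟨j, h⟩, by simp⟩

theorem contentAt_one (T : StandardTableau μ) : T.contentAt 1 = 0 := by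
  by_cases h : 1 ∈ Finset.Icc 1 μ.card
  · obtain ⟨x, hx⟩ := T.exists_entry_eq h
    have h0 : ((0, 0) : ℕ × ℕ) ∈ μ.cells :=
      (YoungDiagram.mem_cells _).2 (μ.up_left_mem (Nat.zero_le x.1.1) (Nat.zero_le x.1.2)
        ((YoungDiagram.mem_cells _).1 x.2))
    have hx0 : (⟨(0, 0), h0⟩ : {x // x ∈ μ.cells}) = x := by
      by_contra hne
      have h1 := T.entry_lt_of_le_of_ne (Nat.zero_le x.1.1) (Nat.zero_le x.1.2) hne
      have h2 := (Finset.mem_Icc.1 (T.entry ⟨(0, 0), h0⟩).2).1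
      omega
    rw [← hx, T.contentAt_entry, ← hx0]
    simp [content]
  -- The diagram is empty, and the default value of `contentAt` is zero.
  · exact dif_neg h

/-- Two boxes on the same diagonal have entries that differ by at least three. -/
theorem entry_add_three_le (T : StandardTableau μ) {x y : {x // x ∈ μ.cells}}
    (hc : content x.1 = content y.1) (hlt : (T.entry x : ℕ) < T.entry y) :
    (T.entry x : ℕ) + 3 ≤ T.entry y := by
  obtain ⟨⟨r, k⟩, hx⟩ := x
  obtain ⟨⟨r', k'⟩, hy⟩ := y
  simp only [content] at hc
  have hr : r < r' := by
    by_contra hr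
    rcases (not_lt.1 hr).eq_or_lt with rfl | hr
    · obtain rfl : k = k' := by omega
      exact lt_irrefl _ hlt
    · have := T.entry_lt_of_le_of_ne (x := ⟨(r', k'), hy⟩) (y := ⟨(r, k), hx⟩)
        (by simp only; omega) (by simp only; omega) (by simp; omega)
      omega
  -- The right and lower neighbours of the first box both carry entries strictly between the two
  -- given ones.
  have h1 : (r, k + 1) ∈ μ.cells := (YoungDiagram.mem_cells _).2
    (μ.up_left_mem hr.le (by omega) ((YoungDiagram.mem_cells _).1 hy))
  have h2 : (r + 1, k) ∈ μ.cells := (YoungDiagram.mem_cells _).2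
    (μ.up_left_mem hr (by omega) ((YoungDiagram.mem_cells _).1 hy))
  have a1 := T.entry_lt_of_le_of_ne (x := ⟨(r, k), hx⟩) (y := ⟨(r, k + 1), h1⟩)
    (by simp) (by simp) (by simp)
  have a2 := T.entry_lt_of_le_of_ne (x := ⟨(r, k), hx⟩) (y := ⟨(r + 1, k), h2⟩)
    (by simp) (by simp) (by simp)
  have b1 := T.entry_lt_of_le_of_ne (x := ⟨(r, k + 1), h1⟩) (y := ⟨(r', k'), hy⟩)
    (by simp only; omega) (by simp only; omega) (by simp; omega)
  have b2 := T.entry_lt_of_le_of_ne (x := ⟨(r + 1, k), h2⟩) (y := ⟨(r', k'), hy⟩)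
    (by simp only; omega) (by simp only; omega) (by simp; omega)
  have hne : (T.entry ⟨(r, k + 1), h1⟩ : ℕ) ≠ T.entry ⟨(r + 1, k), h2⟩ := by
    intro h
    simpa using T.entry.injective (Subtype.ext h)
  omega

/-- This gives the distinctness hypotheses of the braid argument for `j`, `j + 1`, `j + 2`. -/
theorem contentAt_ne_contentAt (T : StandardTableau μ) {i j : ℕ}
    (hi : i ∈ Finset.Icc 1 μ.card) (hj : j ∈ Finset.Icc 1 μ.card) (hij : i < j)
    (hji : j < i + 3) : T.contentAt i ≠ T.contentAt j := by
  obtain ⟨x, rfl⟩ := T.exists_entry_eq hi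
  obtain ⟨y, rfl⟩ := T.exists_entry_eq hj
  rw [T.contentAt_entry, T.contentAt_entry]
  intro h
  have := T.entry_add_three_le h hij
  omega

/-- A box between the two would need an entry between consecutive integers. With the column
analogue, this shows that non-adjacent contents permit the exchange. -/
theorem content_sub_of_row_eq (T : StandardTableau μ) {x y : {x // x ∈ μ.cells}}
    (h : (T.entry y : ℕ) = T.entry x + 1) (hr : x.1.1 = y.1.1) (hc : x.1.2 < y.1.2) :
    content y.1 - content x.1 = 1 := by
  obtain ⟨⟨r, k⟩, hx⟩ := x
  obtain ⟨⟨r', k'⟩, hy⟩ := y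
  obtain rfl : r = r' := hr
  simp only at hc
  by_contra hne
  have hlt : k + 1 < k' := by simp only [content] at hne; omega
  have hz : (r, k + 1) ∈ μ.cells := (YoungDiagram.mem_cells _).2
    (μ.up_left_mem le_rfl hc ((YoungDiagram.mem_cells _).1 hy))
  have h1 := T.row_strict ⟨(r, k), hx⟩ ⟨(r, k + 1), hz⟩ rfl (Nat.lt_succ_self k)
  have h2 := T.row_strict ⟨(r, k + 1), hz⟩ ⟨(r, k'), hy⟩ rfl hlt
  omega

theorem content_sub_of_col_eq (T : StandardTableau μ) {x y : {x // x ∈ μ.cells}}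
    (h : (T.entry y : ℕ) = T.entry x + 1) (hc : x.1.2 = y.1.2) (hr : x.1.1 < y.1.1) :
    content y.1 - content x.1 = -1 := by
  obtain ⟨⟨r, k⟩, hx⟩ := x
  obtain ⟨⟨r', k'⟩, hy⟩ := y
  obtain rfl : k = k' := hc
  simp only at hr
  by_contra hne
  have hlt : r + 1 < r' := by simp only [content] at hne; omega
  have hz : (r + 1, k) ∈ μ.cells := (YoungDiagram.mem_cells _).2
    (μ.up_left_mem hr le_rfl ((YoungDiagram.mem_cells _).1 hy))
  have h1 := T.col_strict ⟨(r, k), hx⟩ ⟨(r + 1, k), hz⟩ rfl (Nat.lt_succ_self r)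
  have h2 := T.col_strict ⟨(r + 1, k), hz⟩ ⟨(r', k), hy⟩ rfl hlt
  omega

/-! ### Exchanging consecutive entries -/

/-- The entries `j` and `j + 1` lie in boxes whose contents differ by exactly one. -/
def Adjacent (T : StandardTableau μ) (j : ℕ) : Prop :=
  T.contentAt (j + 1) - T.contentAt j = 1 ∨ T.contentAt (j + 1) - T.contentAt j = -1

/-- No integer lies between `j` and `j + 1`, so the transposition reverses no other comparison. -/
theorem swap_lt_swap {j : ℕ} {hj : j ∈ Finset.Icc 1 μ.card} {hj' : j + 1 ∈ Finset.Icc 1 μ.card}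
    {p q : {k // k ∈ Finset.Icc 1 μ.card}} (hpq : (p : ℕ) < q)
    (h : ¬((p : ℕ) = j ∧ (q : ℕ) = j + 1)) :
    ((Equiv.swap ⟨j, hj⟩ ⟨j + 1, hj'⟩ p : {k // k ∈ Finset.Icc 1 μ.card}) : ℕ) <
      (Equiv.swap ⟨j, hj⟩ ⟨j + 1, hj'⟩ q : {k // k ∈ Finset.Icc 1 μ.card}) := by
  obtain ⟨p, hp⟩ := p
  obtain ⟨q, hq⟩ := q
  simp only [Equiv.swap_apply_def, Subtype.mk.injEq]
  simp only at hpq h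
  split_ifs <;> simp only <;> omega

/-- Exchange the entries `j` and `j + 1`. -/
def swapEntries (T : StandardTableau μ) {j : ℕ} (hj : j ∈ Finset.Icc 1 μ.card)
    (hj' : j + 1 ∈ Finset.Icc 1 μ.card) (h : ¬T.Adjacent j) : StandardTableau μ where
  entry := T.entry.trans (Equiv.swap ⟨j, hj⟩ ⟨j + 1, hj'⟩)
  row_strict x y h1 h2 := by
    refine swap_lt_swap (T.row_strict x y h1 h2) fun ⟨hx, hy⟩ => h (Or.inl ?_)
    rw [← hy, ← hx, T.contentAt_entry, T.contentAt_entry]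
    exact T.content_sub_of_row_eq (by omega) h1 h2
  col_strict x y h1 h2 := by
    refine swap_lt_swap (T.col_strict x y h1 h2) fun ⟨hx, hy⟩ => h (Or.inr ?_)
    rw [← hy, ← hx, T.contentAt_entry, T.contentAt_entry]
    exact T.content_sub_of_col_eq (by omega) h1 h2

section

variable {j : ℕ} (hj : j ∈ Finset.Icc 1 μ.card) (hj' : j + 1 ∈ Finset.Icc 1 μ.card)

theorem contentAt_swapEntries (T : StandardTableau μ) (h : ¬T.Adjacent j) (k : ℕ) :
    (T.swapEntries hj hj' h).contentAt k = T.contentAt (Equiv.swap j (j + 1) k) := by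
  by_cases hk : k ∈ Finset.Icc 1 μ.card
  · have hval : (Equiv.swap (⟨j, hj⟩ : {k // k ∈ Finset.Icc 1 μ.card}) ⟨j + 1, hj'⟩ ⟨k, hk⟩ : ℕ) =
        Equiv.swap j (j + 1) k := by
      simp only [Equiv.swap_apply_def, Subtype.mk.injEq]
      split_ifs <;> rfl
    rw [contentAt_of_mem _ hk, ← hval, contentAt_of_mem _ (Subtype.property _)]
    simp [box, swapEntries]
  · have hk' : Equiv.swap j (j + 1) k = k := by
      apply Equiv.swap_apply_of_ne_of_ne <;> rintro rfl <;> contradiction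
    rw [hk']
    simp only [contentAt, dif_neg hk]

open Classical in
/-- Exchange the entries `j` and `j + 1` unless they are adjacent. -/
noncomputable def partialSwap (T : StandardTableau μ) : StandardTableau μ :=
  if h : T.Adjacent j then T else T.swapEntries hj hj' h

theorem partialSwap_of_adjacent {T : StandardTableau μ} (h : T.Adjacent j) :
    T.partialSwap hj hj' = T := dif_pos h

theorem contentAt_partialSwap {T : StandardTableau μ} (h : ¬T.Adjacent j) (k : ℕ) :
    (T.partialSwap hj hj').contentAt k = T.contentAt (Equiv.swap j (j + 1) k) := by
  rw [partialSwap, dif_neg h, contentAt_swapEntries]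

theorem partialSwap_involutive : Function.Involutive (partialSwap hj hj') := by
  intro T
  by_cases h : T.Adjacent j
  · rw [partialSwap_of_adjacent hj hj' h, partialSwap_of_adjacent hj hj' h]
  · have h' : ¬(T.partialSwap hj hj').Adjacent j := by
      simp only [Adjacent, contentAt_partialSwap hj hj' h, Equiv.swap_apply_left,
        Equiv.swap_apply_right] at h ⊢
      omega
    rw [partialSwap, dif_neg h']
    ext1
    simp only [swapEntries, partialSwap, dif_neg h]
    ext x
    simp

end

/-! ### Sums over all tableaux and the expectation -/

theorem sum_contentAt_sub (j : ℕ) (hj : j ∈ Finset.Icc 1 μ.card)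
    (hj' : j + 1 ∈ Finset.Icc 1 μ.card) :
    ∑ T : StandardTableau μ, (T.contentAt (j + 1) - T.contentAt j) =
      ∑ T : StandardTableau μ, unitDiff (T.contentAt j) (T.contentAt (j + 1)) :=
  sum_sub_eq_sum_unitDiff (partialSwap_involutive hj hj')
    (fun _ h => partialSwap_of_adjacent hj hj' h) fun T h => by
      have h : ¬T.Adjacent j := h
      simp [contentAt_partialSwap hj hj' h]

theorem sum_unitDiff_contentAt_succ (j : ℕ) (hj : j ∈ Finset.Icc 1 μ.card)
    (hj' : j + 1 ∈ Finset.Icc 1 μ.card) (hj'' : j + 1 + 1 ∈ Finset.Icc 1 μ.card) :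
    ∑ T : StandardTableau μ, unitDiff (T.contentAt j) (T.contentAt (j + 1)) =
      ∑ T : StandardTableau μ, unitDiff (T.contentAt (j + 1)) (T.contentAt (j + 1 + 1)) := by
  refine sum_unitDiff_eq_sum_unitDiff (partialSwap_involutive hj hj')
    (partialSwap_involutive hj' hj'')
    (fun T => T.contentAt_ne_contentAt hj hj' (by omega) (by omega))
    (fun T => T.contentAt_ne_contentAt hj' hj'' (by omega) (by omega))
    (fun T => T.contentAt_ne_contentAt hj hj'' (by omega) (by omega))
    (fun _ h => partialSwap_of_adjacent hj hj' h) (fun T h => ?_)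
    (fun _ h => partialSwap_of_adjacent hj' hj'' h) (fun T h => ?_)
  · have h : ¬T.Adjacent j := h
    have e : Equiv.swap j (j + 1) (j + 1 + 1) = j + 1 + 1 :=
      Equiv.swap_apply_of_ne_of_ne (by omega) (by omega)
    simp only [contentAt_partialSwap hj hj' h, Equiv.swap_apply_left, Equiv.swap_apply_right, e,
      and_self]
  · have h : ¬T.Adjacent (j + 1) := h
    have e : Equiv.swap (j + 1) (j + 1 + 1) j = j :=
      Equiv.swap_apply_of_ne_of_ne (by omega) (by omega)
    simp only [contentAt_partialSwap hj' hj'' h, Equiv.swap_apply_left, Equiv.swap_apply_right, e,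
      and_self]

theorem sum_unitDiff_contentAt (j : ℕ) (hj : j + 2 ≤ μ.card) :
    ∑ T : StandardTableau μ, unitDiff (T.contentAt (j + 1)) (T.contentAt (j + 1 + 1)) =
      ∑ T : StandardTableau μ, unitDiff (T.contentAt 1) (T.contentAt 2) := by
  induction j with
  | zero => rfl
  | succ j ih =>
    rw [← ih (by omega)]
    exact (sum_unitDiff_contentAt_succ (j + 1) (Finset.mem_Icc.2 (by omega))
      (Finset.mem_Icc.2 (by omega)) (Finset.mem_Icc.2 (by omega))).symm

theorem sum_contentAt_succ (j : ℕ) (hj : j + 1 ≤ μ.card) :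
    ∑ T : StandardTableau μ, T.contentAt (j + 1) =
      j * ∑ T : StandardTableau μ, unitDiff (T.contentAt 1) (T.contentAt 2) := by
  induction j with
  | zero => simp [contentAt_one]
  | succ j ih =>
    have h := sum_contentAt_sub (μ := μ) (j + 1) (Finset.mem_Icc.2 (by omega))
      (Finset.mem_Icc.2 (by omega))
    rw [Finset.sum_sub_distrib, ih (by omega), sum_unitDiff_contentAt j hj] at h
    push_cast
    linarith

theorem sum_range_contentAt (T : StandardTableau μ) :
    ∑ j ∈ Finset.range μ.card, T.contentAt (j + 1) = ∑ x ∈ μ.cells, content x := by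
  rw [Finset.range_eq_Ico, Finset.sum_Ico_add' T.contentAt 0 μ.card 1,
    ← Finset.sum_coe_sort μ.cells content]
  have h : Finset.Ico (0 + 1) (μ.card + 1) = Finset.Icc 1 μ.card := by
    ext k
    simp only [Finset.mem_Ico, Finset.mem_Icc]
    omega
  rw [h, ← Finset.sum_coe_sort (Finset.Icc 1 μ.card) T.contentAt]
  exact (Fintype.sum_equiv T.entry _ _ fun x => (T.contentAt_entry x).symm).symm

/-- Double counting: every tableau has the same total content, while summing over tableaux first
gives the factor `0 + 1 + ⋯ + (μ.card - 1)`. -/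
theorem card_mul_sum_content :
    (Fintype.card (StandardTableau μ) : ℤ) * ∑ x ∈ μ.cells, content x =
      μ.card.choose 2 *
        ∑ T : StandardTableau μ, unitDiff (T.contentAt 1) (T.contentAt 2) := by
  have h : ∑ T : StandardTableau μ, ∑ j ∈ Finset.range μ.card, T.contentAt (j + 1) =
      Fintype.card (StandardTableau μ) * ∑ x ∈ μ.cells, content x := by
    simp [sum_range_contentAt]
  rw [← h, Finset.sum_comm, Finset.sum_congr rfl fun j hj =>
    sum_contentAt_succ j (Finset.mem_range.1 hj), ← Finset.sum_mul, ← Nat.cast_sum,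
    Finset.sum_range_id, Nat.choose_two_right]

theorem integral_uniform (f : StandardTableau μ → ℝ) :
    ∫ T, f T ∂(uniform μ) = (∑ T, f T) / Fintype.card (StandardTableau μ) := by
  have : MeasurableSingletonClass (StandardTableau μ) := ⟨fun _ => trivial⟩
  rw [uniform, PMF.integral_eq_sum, Finset.sum_div]
  refine Finset.sum_congr rfl fun T _ => ?_
  simp [PMF.uniformOfFintype_apply, div_eq_inv_mul]

end StandardTableau

end YoungDiagram

theorem mainTheorem11 (μ : YoungDiagram) (hμ : 2 ≤ μ.card) (j : ℕ)
    (hj : j ∈ Finset.Icc 1 μ.card) :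
    ∫ T, (YoungDiagram.content (T.box ⟨j, hj⟩) : ℝ) ∂(YoungDiagram.StandardTableau.uniform μ) =
      ((j : ℝ) - 1) / (μ.card.choose 2 : ℝ) *
        ∑ x ∈ μ.cells, (YoungDiagram.content x : ℝ) := by
  have hj' := Finset.mem_Icc.1 hj
  have hsum := YoungDiagram.StandardTableau.sum_contentAt_succ (μ := μ) (j - 1) (by omega)
  rw [Nat.sub_add_cancel hj'.1, Nat.cast_sub hj'.1] at hsum
  have hcard := YoungDiagram.StandardTableau.card_mul_sum_content (μ := μ)
  have hsum' := congrArg (Int.cast : ℤ → ℝ) hsum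
  have hcard' := congrArg (Int.cast : ℤ → ℝ) hcard
  push_cast at hsum' hcard'
  have hchoose : (μ.card.choose 2 : ℝ) ≠ 0 := by
    exact_mod_cast (Nat.choose_pos hμ).ne'
  have hf : (Fintype.card (YoungDiagram.StandardTableau μ) : ℝ) ≠ 0 := by
    exact_mod_cast Fintype.card_ne_zero
  simp_rw [← fun T : YoungDiagram.StandardTableau μ => T.contentAt_of_mem hj]
  rw [YoungDiagram.StandardTableau.integral_uniform, hsum', div_mul_eq_mul_div,
    div_eq_div_iff hf hchoose]
  linear_combination (1 - (j : ℝ)) * hcard'
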